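/- Let $\mathcal H$ be a complex Hilbert space and let $H$ be an unbounded self-adjoint operator on $\mathcal H$ with discrete spectrum: there is an orthonormal basis $(b_n)_{n\in\mathbb N}$ of eigenvectors, $Hb_n=E_nb_n$, and only finitely many of the $E_n$ lie below any given bound. Assume that the smallest eigenvalue is $0$ and that $H$ satisfies the Gibbs hypothesis $\operatorname{Tr}e^{-\beta H}<\infty$ for every $\beta>0$. For $E>0$ let $\gamma(E)$ be the Gibbs state $e^{-\beta H}/\operatorname{Tr}e^{-\beta H}$ with $\beta>0$ such that $\operatorname{Tr}(H\gamma(E))=E$, and let $\gamma(0)$ be the normalized projection onto the ground space $\ker H$. Write $S(\rho)=-\operatorname{Tr}(\rho\log_2\rho)$ and $h(p)=-p\log_2p-(1-p)\log_2(1-p)$. Let $E\ge 0$ and let $\rho,\sigma$ be density operators with spectral decompositions $$\rho=\sum_i r_i|e_i\rangle\langle e_i|,\qquad \sigma=\sum_i s_i|f_i\rangle\langle f_i|$$ ($(e_i)$ and $(f_i)$ countable orthonormal families, $r_i,s_i\ge0$, $\sum_ir_i=\sum_is_i=1$), in which every pure state that occurs has energy at most $E$: $\langle e_i|H|e_i\rangle\le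 E$ whenever $r_i\neq0$, and $\langle f_i|H|f_i\rangle\le E$ whenever $s_i\neq0$. Let $\epsilon=\frac12\|\rho-\sigma\|_1\le1$. Then $S(\rho)$, $S(\sigma)$ and $S(\gamma(E))$ are finite and $$|S(\rho)-S(\sigma)|\le 2\epsilon\,S(\gamma(E))+h(\epsilon).$$ -/

import Mathlib

open scoped ENNReal NNReal InnerProductSpace

noncomputable section

namespace EntropyBound

variable {𝓗 : Type*} [NormedAddCommGroup 𝓗] [InnerProductSpace ℂ 𝓗] [CompleteSpace 𝓗]

/-- The pure-state operator `|ψ⟩⟨ψ|`. -/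
def ketBra (ψ : 𝓗) : 𝓗 →L[ℂ] 𝓗 := InnerProductSpace.rankOne ℂ ψ ψ

/-- The diagonal sum `∑ᵢ ⟨bᵢ, A bᵢ⟩ ∈ [0, ∞]` of a positive operator in a Hilbert basis. -/
def traceIn {ι : Type*} (b : HilbertBasis ι ℂ 𝓗) (A : 𝓗 →L[ℂ] 𝓗) : ℝ≥0∞ :=
  ∑' i, ENNReal.ofReal (⟪b i, A (b i)⟫_ℂ).re

variable (𝓗) in
/-- Index set of some orthonormal basis of the Hilbert space. -/
def StdIndex : Set 𝓗 := (exists_hilbertBasis ℂ 𝓗).choose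

variable (𝓗) in
/-- Some orthonormal basis of the Hilbert space. -/
def stdBasis : HilbertBasis (StdIndex 𝓗) ℂ 𝓗 := (exists_hilbertBasis ℂ 𝓗).choose_spec.choose

/-- The trace `Tr A ∈ [0, ∞]` of a positive operator. It is only ever applied to positive operators;
for these it can be computed in every orthonormal basis, see `trace_eq_traceIn`. -/
def trace (A : 𝓗 →L[ℂ] 𝓗) : ℝ≥0∞ := traceIn (stdBasis 𝓗) A

/-- Parseval's identity in `[0, ∞]`. -/
theorem tsum_enorm_sq {ι : Type*} (b : HilbertBasis ι ℂ 𝓗) (x : 𝓗) :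
    ∑' i, ENNReal.ofReal (‖⟪b i, x⟫_ℂ‖ ^ 2) = ENNReal.ofReal (‖x‖ ^ 2) := by
  have h := b.hasSum_inner_mul_inner x x
  have h2 : HasSum (fun i => ‖⟪b i, x⟫_ℂ‖ ^ 2) (‖x‖ ^ 2) := by
    have h3 := Complex.hasSum_re h
    have e1 : (⟪x, x⟫_ℂ).re = ‖x‖ ^ 2 := by
      rw [inner_self_eq_norm_sq_to_K]
      norm_cast
    rw [e1] at h3
    refine h3.congr_fun ?_
    intro i
    rw [← inner_conj_symm x (b i), ← Complex.normSq_eq_conj_mul_self, Complex.normSq_eq_norm_sq]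
    norm_cast
  rw [← h2.tsum_eq, ENNReal.ofReal_tsum_of_nonneg (fun i => by positivity) h2.summable]

/-- The trace of a positive operator does not depend on the orthonormal basis. -/
theorem trace_eq_traceIn {ι : Type*} (b : HilbertBasis ι ℂ 𝓗) {A : 𝓗 →L[ℂ] 𝓗}
    (hA : A.IsPositive) : trace A = traceIn b A := by
  have hA0 : 0 ≤ A := (ContinuousLinearMap.nonneg_iff_isPositive A).2 hA
  set B : 𝓗 →L[ℂ] 𝓗 := CFC.sqrt A with hB
  have hBsa : IsSelfAdjoint B := (CFC.sqrt_nonneg A).isSelfAdjoint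
  have hBB : B * B = A := CFC.sqrt_mul_sqrt_self A hA0
  have hsym : ∀ x y : 𝓗, ⟪x, B y⟫_ℂ = ⟪B x, y⟫_ℂ := fun x y => by
    have := ContinuousLinearMap.adjoint_inner_left B y x
    rw [ContinuousLinearMap.isSelfAdjoint_iff'.1 hBsa] at this
    exact this.symm
  have hd : ∀ x : 𝓗, (⟪x, A x⟫_ℂ).re = ‖B x‖ ^ 2 := fun x => by
    rw [← hBB, mul_apply_eq_comp, hsym, inner_self_eq_norm_sq_to_K]
    norm_cast
  unfold trace traceIn
  simp_rw [hd, ← tsum_enorm_sq b]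
  rw [ENNReal.tsum_comm]
  refine tsum_congr fun j => ?_
  rw [tsum_enorm_sq b, ← tsum_enorm_sq (stdBasis 𝓗)]
  refine tsum_congr fun i => ?_
  rw [hsym, norm_inner_symm]

/-- The trace norm `‖A‖₁ = Tr |A|`. -/
def traceNorm (A : 𝓗 →L[ℂ] 𝓗) : ℝ≥0∞ := trace (CFC.abs A)

/-- Density operators: positive operators of trace one. -/
def IsDensityOperator (ρ : 𝓗 →L[ℂ] 𝓗) : Prop := ρ.IsPositive ∧ trace ρ = 1

/-- The function `x ↦ -x log₂ x`, with value `0` at `x = 0`. -/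
def negMulLogTwo (x : ℝ) : ℝ := Real.negMulLog x / Real.log 2

/-- The von Neumann entropy `S(ρ) = -Tr (ρ log₂ ρ) ∈ [0, ∞]` of a density operator; the operator
`-ρ log₂ ρ`, given by the continuous functional calculus, is positive. -/
def entropy (ρ : 𝓗 →L[ℂ] 𝓗) : ℝ≥0∞ := trace (cfc negMulLogTwo ρ)

/-- The binary entropy `h(p) = -p log₂ p - (1 - p) log₂ (1 - p)`. -/
def binaryEntropy (p : ℝ) : ℝ := negMulLogTwo p + negMulLogTwo (1 - p)

variable (𝓗) in
/-- A Hamiltonian: an unbounded self-adjoint operator with discrete spectrum (there is an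
orthonormal basis of eigenvectors, indexed by `ℕ`, and only finitely many of the eigenvalues,
counted with multiplicity, lie below any given bound) and with ground state energy `0`. -/
structure Hamiltonian where
  /-- the operator, with its domain -/
  op : 𝓗 →ₗ.[ℂ] 𝓗
  isSelfAdjoint : IsSelfAdjoint op
  /-- the orthonormal basis of eigenvectors -/
  basis : HilbertBasis ℕ ℂ 𝓗
  /-- the eigenvalues, with multiplicity -/
  level : ℕ → ℝ
  mem_domain : ∀ n, basis n ∈ op.domain
  apply_basis : ∀ n, op ⟨basis n, mem_domain n⟩ = (level n : ℂ) • basis n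
  discrete : Filter.Tendsto level Filter.cofinite Filter.atTop
  ground : IsLeast (Set.range level) 0

namespace Hamiltonian

variable (H : Hamiltonian 𝓗)

/-- The energy `Tr (H ρ) = Tr (√H ρ √H) ∈ [0, ∞]` of a positive operator `ρ`, computed in the
eigenbasis of `H`. -/
def energy (ρ : 𝓗 →L[ℂ] 𝓗) : ℝ≥0∞ :=
  ∑' n, ENNReal.ofReal (H.level n * (⟪H.basis n, ρ (H.basis n)⟫_ℂ).re)

/-- The Gibbs hypothesis: `Tr e^{-βH} < ∞` for every `β > 0`. -/
def GibbsHypothesis : Prop :=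
  ∀ β : ℝ, 0 < β → Summable fun n => Real.exp (-β * H.level n)

/-- The state `(∑ₙ wₙ |n⟩⟨n|) / (∑ₙ wₙ)` that is diagonal in the eigenbasis `|n⟩` of `H`, for
summable weights `wₙ ≥ 0`; the series of operators converges in norm. -/
def diagonalState (w : ℕ → ℝ) : 𝓗 →L[ℂ] 𝓗 :=
  ∑' n, ((w n / ∑' m, w m : ℝ) : ℂ) • ketBra (H.basis n)

/-- The Gibbs state `e^{-βH} / Tr e^{-βH}`. -/
def gibbsState (β : ℝ) : 𝓗 →L[ℂ] 𝓗 :=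
  H.diagonalState fun n => Real.exp (-β * H.level n)

open scoped Classical in
/-- The Gibbs state at zero temperature: the normalized projection onto the ground space. -/
def groundState : 𝓗 →L[ℂ] 𝓗 :=
  H.diagonalState fun n => if H.level n = 0 then 1 else 0

/-- `γ` is the thermal state `γ(E)` of energy `E`: for `E > 0` it is the Gibbs state at the inverse
temperature at which the energy is `E`, and for `E = 0` it is the Gibbs state at zero temperature
(a Gibbs state with `0 < β < ∞` has positive energy). -/
def IsThermalState (E : ℝ≥0) (γ : 𝓗 →L[ℂ] 𝓗) : Prop :=
  (∃ β : ℝ, 0 < β ∧ γ = H.gibbsState β ∧ H.energy γ = E) ∨ (E = 0 ∧ γ = H.groundState)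

/-- `ρ` has a spectral decomposition `ρ = ∑ᵢ rᵢ |eᵢ⟩⟨eᵢ|`, that is, it is an orthonormal countable
convex combination of pure states, in which every pure state that occurs (with `rᵢ ≠ 0`) has energy
`⟨eᵢ|H|eᵢ⟩` at most `E`. -/
def IsMixtureOfEnergyLE (E : ℝ≥0) (ρ : 𝓗 →L[ℂ] 𝓗) : Prop :=
  ∃ (r : ℕ → ℝ) (e : ℕ → 𝓗), Orthonormal ℂ e ∧ (∀ i, 0 ≤ r i) ∧ HasSum r 1 ∧
    (∀ i, r i ≠ 0 → H.energy (ketBra (e i)) ≤ E) ∧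
    HasSum (fun i => (r i : ℂ) • ketBra (e i)) ρ

/-- For a vector `ψ` in the domain of `H`, the energy of `|ψ⟩⟨ψ|` is `⟨ψ, H ψ⟩`. -/
theorem energy_ketBra (ψ : H.op.domain) :
    H.energy (ketBra (ψ : 𝓗)) = ENNReal.ofReal (⟪(ψ : 𝓗), H.op ψ⟫_ℂ).re := by
  have hl : ∀ n, 0 ≤ H.level n := fun n => H.ground.2 ⟨n, rfl⟩
  have hadj : ∀ n, ⟪H.basis n, H.op ψ⟫_ℂ = (H.level n : ℂ) * ⟪H.basis n, (ψ : 𝓗)⟫_ℂ := fun n => by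
    have h1 := LinearPMap.adjoint_isFormalAdjoint H.isSelfAdjoint.dense_domain
    rw [LinearPMap.isSelfAdjoint_def.1 H.isSelfAdjoint] at h1
    rw [← h1 ⟨H.basis n, H.mem_domain n⟩ ψ, H.apply_basis, inner_smul_left, Complex.conj_ofReal]
  have hterm : ∀ n, (⟪(ψ : 𝓗), H.basis n⟫_ℂ * ⟪H.basis n, H.op ψ⟫_ℂ).re =
      H.level n * (⟪H.basis n, ketBra (ψ : 𝓗) (H.basis n)⟫_ℂ).re := fun n => by
    rw [hadj, ketBra, InnerProductSpace.rankOne_apply, inner_smul_right, ← Complex.re_ofReal_mul]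
    congr 1
    ring
  have hs := Complex.hasSum_re (H.basis.hasSum_inner_mul_inner (ψ : 𝓗) (H.op ψ))
  simp only [hterm] at hs
  rw [energy, ← hs.tsum_eq, ENNReal.ofReal_tsum_of_nonneg _ hs.summable]
  intro n
  refine mul_nonneg (hl n) ?_
  rw [ketBra, InnerProductSpace.rankOne_apply, inner_smul_right, ← inner_conj_symm (ψ : 𝓗),
    ← Complex.normSq_eq_conj_mul_self]
  exact Complex.normSq_nonneg _

end Hamiltonian

end EntropyBound

end

namespace EntropyBound

variable {𝓗 : Type*} [NormedAddCommGroup 𝓗] [InnerProductSpace ℂ 𝓗] [CompleteSpace 𝓗]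

/-! The problem reduces to probability distributions. Let `r` and `s` be the eigenvalues of ρ and σ
in decreasing order. Mirsky's inequality (`sum_max_le_of_traceNorm`) bounds ∑ max(rᵢ, sᵢ) by 1 + ε,
so the positive part of r - s has mass δ ≤ ε. If δ > 0, cutting r into min(r, s) and this positive
part gives H(r) - H(s) ≤ h(δ) + δ H(t) with t = (r - s)₊ / δ (`tsum_negMulLog_sub_le`); if δ = 0,
then r = s.

The energy hypothesis enters through supports: tᵢ ≠ 0 forces rᵢ ≠ 0, so ∑ tᵢ |eᵢ⟩⟨eᵢ| is again a
mixture of pure states of energy at most E, and the Gibbs variational principle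
(`tsum_ofReal_negMulLog_le`) gives H(t) ≤ S(γ(E)). For ε ≤ 1/2 monotonicity of h finishes, even
without the factor 2; for ε ≥ 1/2 already S(ρ) ≤ S(γ(E)) ≤ 2ε S(γ(E)) suffices. Exchanging ρ and σ
gives the absolute value. -/

/-! ### Entropy of an operator with a spectral decomposition -/

theorem cfc_apply_of_apply_eq_smul {A : 𝓗 →L[ℂ] 𝓗} (hA : IsSelfAdjoint A) {f : ℝ → ℝ}
    (hf : Continuous f) {c : ℝ} {v : 𝓗} (hv : A v = (c : ℂ) • v) :
    cfc f A v = (f c : ℂ) • v := by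
  rcases eq_or_ne v 0 with rfl | hv0
  · simp
  have hc : c ∈ spectrum ℝ A := by
    rw [spectrum.mem_iff]
    intro hu
    obtain ⟨u, hu⟩ := hu
    have h0 : (u : 𝓗 →L[ℂ] 𝓗) v = 0 := by
      rw [hu]
      simp [Algebra.algebraMap_eq_smul_one, hv]
    have h1 : (↑u⁻¹ * (u : 𝓗 →L[ℂ] 𝓗)) v = 0 := by
      rw [mul_apply_eq_comp, h0, map_zero]
    rw [Units.inv_mul] at h1
    exact hv0 (by simpa using h1)
  -- By Stone–Weierstrass it suffices to check constants and the identity: the property is closed in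
  -- `g` and stable under sums and products.
  have key : ∀ g : C(spectrum ℝ A, ℝ), cfcHom (R := ℝ) hA g v = (g ⟨c, hc⟩ : ℂ) • v := by
    intro g
    induction g using ContinuousMap.induction_on_of_compact with
    | const r =>
      have : ContinuousMap.const (spectrum ℝ A) r = algebraMap ℝ _ r := rfl
      rw [this, AlgHomClass.commutes]
      simp [Algebra.algebraMap_eq_smul_one]
    | id => rw [cfcHom_id]; exact hv
    | star_id => rw [map_star, cfcHom_id, hA.star_eq]; exact hv
    | add g₁ g₂ h₁ h₂ => simp [h₁, h₂, add_smul]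
    | mul g₁ g₂ h₁ h₂ =>
      rw [map_mul, mul_apply_eq_comp, h₂, map_smul, h₁, smul_smul, mul_comm]
      norm_cast
    | frequently g h =>
      refine h.mem_of_closed (isClosed_eq ?_ ?_)
      · exact ((ContinuousLinearMap.apply ℂ 𝓗 v).continuous).comp (cfcHom_continuous hA)
      · fun_prop
  rw [cfc_apply f A hA hf.continuousOn, key]
  rfl

theorem continuous_negMulLogTwo : Continuous negMulLogTwo :=
  Real.continuous_negMulLog.div_const _

theorem negMulLogTwo_nonneg {x : ℝ} (h0 : 0 ≤ x) (h1 : x ≤ 1) : 0 ≤ negMulLogTwo x :=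
  div_nonneg (Real.negMulLog_nonneg h0 h1) (Real.log_nonneg one_le_two)

theorem ketBra_apply (ψ x : 𝓗) : ketBra ψ x = ⟪ψ, x⟫_ℂ • ψ := rfl

section Diagonal

variable {r : ℕ → ℝ} {e : ℕ → 𝓗} {ρ : 𝓗 →L[ℂ] 𝓗}

theorem hasSum_apply_of_hasSum_ketBra (hρ : HasSum (fun i => (r i : ℂ) • ketBra (e i)) ρ) (x : 𝓗) :
    HasSum (fun i => ((r i : ℂ) * ⟪e i, x⟫_ℂ) • e i) (ρ x) := by
  refine (hρ.mapL (ContinuousLinearMap.apply ℂ 𝓗 x)).congr_fun fun i => ?_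
  rw [mul_smul]
  rfl

theorem apply_eq_of_hasSum_ketBra (he : Orthonormal ℂ e)
    (hρ : HasSum (fun i => (r i : ℂ) • ketBra (e i)) ρ) (i : ℕ) : ρ (e i) = (r i : ℂ) • e i := by
  refine (hasSum_apply_of_hasSum_ketBra hρ (e i)).unique ?_
  convert hasSum_single i ?_ using 1
  · simp [he.norm_eq_one]
  · intro j hj
    simp [he.inner_eq_zero hj]

theorem apply_eq_zero_of_hasSum_ketBra
    (hρ : HasSum (fun i => (r i : ℂ) • ketBra (e i)) ρ) {x : 𝓗} (hx : ∀ i, ⟪e i, x⟫_ℂ = 0) :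
    ρ x = 0 := by
  refine (hasSum_apply_of_hasSum_ketBra hρ x).unique ?_
  simp [hx, hasSum_zero]

theorem isPositive_of_hasSum_ketBra (hr : ∀ i, 0 ≤ r i)
    (hρ : HasSum (fun i => (r i : ℂ) • ketBra (e i)) ρ) : ρ.IsPositive := by
  rw [← ContinuousLinearMap.nonneg_iff_isPositive]
  refine hρ.nonneg fun i => ?_
  rw [ContinuousLinearMap.nonneg_iff_isPositive]
  exact (InnerProductSpace.isPositive_rankOne_self (e i)).smul_of_nonneg
    (by exact_mod_cast hr i)

theorem norm_le_of_hasSum_ketBra (he : Orthonormal ℂ e) (hr : ∀ i, 0 ≤ r i) {a : ℝ} (hr1 : HasSum r a)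
    (hρ : HasSum (fun i => (r i : ℂ) • ketBra (e i)) ρ) : ‖ρ‖ ≤ a := by
  rw [← hρ.tsum_eq]
  refine tsum_of_norm_bounded hr1 fun i => ?_
  rw [norm_smul, ketBra, InnerProductSpace.norm_rankOne, he.norm_eq_one]
  simp [abs_of_nonneg (hr i)]

theorem isPositive_cfc_negMulLogTwo (hρ : ρ.IsPositive) (hρ1 : ‖ρ‖ ≤ 1) :
    (cfc negMulLogTwo ρ).IsPositive := by
  rw [← ContinuousLinearMap.nonneg_iff_isPositive] at hρ ⊢
  refine cfc_nonneg fun x hx => negMulLogTwo_nonneg (spectrum_nonneg_of_nonneg hρ hx) ?_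
  by_cases hn : Nontrivial 𝓗
  · exact (le_abs_self x).trans ((spectrum.norm_le_norm_of_mem hx).trans hρ1)
  · have := not_nontrivial_iff_subsingleton.1 hn
    have : Subsingleton (𝓗 →L[ℂ] 𝓗) := inferInstance
    simp [spectrum.of_subsingleton] at hx

/-- An orthonormal family extends to a Hilbert basis. -/
theorem exists_hilbertBasis_extension_family {ι : Type*} {e : ι → 𝓗} (he : Orthonormal ℂ e) :
    ∃ (w : Set 𝓗) (b : HilbertBasis w ℂ 𝓗) (k : ι → w), Function.Injective k ∧
      (∀ i, b (k i) = e i) ∧ ∀ j, j ∉ Set.range k → ∀ i, ⟪e i, b j⟫_ℂ = 0 := by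
  obtain ⟨w, b, hw, hb⟩ := he.toSubtypeRange.exists_hilbertBasis_extension
  have hbe : ∀ i, b ⟨e i, hw ⟨i, rfl⟩⟩ = e i := fun i => by rw [hb]
  refine ⟨w, b, fun i => ⟨e i, hw ⟨i, rfl⟩⟩, ?_, hbe, ?_⟩
  · intro i j hij
    exact he.linearIndependent.injective (congrArg Subtype.val hij)
  · intro j hj i
    rw [← hbe i]
    exact b.orthonormal.inner_eq_zero fun h => hj ⟨i, h⟩

/-- The trace is computed in a basis extending `e`; the added vectors lie in the kernel of ρ and
contribute nothing, since -x log x vanishes at 0. -/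
theorem entropy_eq_tsum (he : Orthonormal ℂ e) (hr : ∀ i, 0 ≤ r i) (hr1 : HasSum r 1)
    (hρ : HasSum (fun i => (r i : ℂ) • ketBra (e i)) ρ) :
    entropy ρ = ∑' i, ENNReal.ofReal (negMulLogTwo (r i)) := by
  have hpos := isPositive_of_hasSum_ketBra hr hρ
  obtain ⟨w, b, k, hk, hbk, hb0⟩ := exists_hilbertBasis_extension_family he
  rw [entropy, trace_eq_traceIn b (isPositive_cfc_negMulLogTwo hpos
    (norm_le_of_hasSum_ketBra he hr hr1 hρ)), traceIn, ← hk.tsum_eq]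
  · refine tsum_congr fun i => ?_
    rw [hbk, cfc_apply_of_apply_eq_smul hpos.isSelfAdjoint continuous_negMulLogTwo
      (apply_eq_of_hasSum_ketBra he hρ i), inner_smul_right, inner_self_eq_norm_sq_to_K,
      he.norm_eq_one]
    simp
  · intro j hj
    by_contra hjk
    refine hj ?_
    have h0 : ρ (b j) = ((0 : ℝ) : ℂ) • b j := by
      rw [apply_eq_zero_of_hasSum_ketBra hρ (hb0 j hjk)]
      simp
    simp only [cfc_apply_of_apply_eq_smul hpos.isSelfAdjoint continuous_negMulLogTwo h0]
    simp [negMulLogTwo]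

end Diagonal

/-! ### Decreasing rearrangement -/

/-- A summable sequence exceeds any positive value only finitely often, so a maximum off `s` is
attained. -/
theorem exists_notMem_forall_le {r : ℕ → ℝ} (hr : ∀ i, 0 ≤ r i) (hs : Summable r) (s : Finset ℕ) :
    ∃ m, m ∉ s ∧ ∀ j, j ∉ s → r j ≤ r m := by
  by_cases h : ∃ j, j ∉ s ∧ 0 < r j
  · obtain ⟨j₀, hj₀, hpos⟩ := h
    have hfin : {j | r j₀ ≤ r j}.Finite := by
      have := hs.tendsto_cofinite_zero.eventually (gt_mem_nhds hpos)
      simpa [Filter.eventually_cofinite] using this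
    obtain ⟨m, hm, hmax⟩ := (hfin.toFinset \ s).exists_max_image r
      ⟨j₀, by simp [hj₀]⟩
    simp only [Finset.mem_sdiff, Set.Finite.mem_toFinset, Set.mem_ofPred_eq] at hm hmax
    refine ⟨m, hm.2, fun j hj => ?_⟩
    by_cases hjj : r j₀ ≤ r j
    · exact hmax j ⟨hjj, hj⟩
    · exact (not_le.1 hjj).le.trans hm.1
  · push Not at h
    obtain ⟨m, hm⟩ := Infinite.exists_notMem_finset s
    exact ⟨m, hm, fun j hj => (h j hj).trans (hr m)⟩

/-- The decreasing rearrangement of a summable sequence of nonnegative reals. -/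
theorem exists_antitone_rearrangement {r : ℕ → ℝ} (hr : ∀ i, 0 ≤ r i) (hs : Summable r) :
    ∃ a : ℕ → ℕ, Function.Injective a ∧ Antitone (r ∘ a) ∧ ∀ i, i ∉ Set.range a → r i = 0 := by
  choose pick hpick hmax using exists_notMem_forall_le hr hs
  -- Greedy choice: `S n` holds the first `n` picks, each maximal among the remaining indices.
  let S : ℕ → Finset ℕ := fun n => Nat.rec ∅ (fun _ s => insert (pick s) s) n
  have hS : ∀ n, S (n + 1) = insert (pick (S n)) (S n) := fun n => rfl
  have hmono : Monotone S := monotone_nat_of_le_succ fun n => by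
    rw [hS]
    exact Finset.subset_insert _ _
  have hlt : ∀ m n, m < n → pick (S m) ≠ pick (S n) := fun m n hmn h => by
    refine hpick (S n) ?_
    rw [← h]
    refine hmono (Nat.succ_le_of_lt hmn) ?_
    rw [Nat.succ_eq_add_one, hS]
    exact Finset.mem_insert_self _ _
  have hinj : Function.Injective fun n => pick (S n) := fun m n h => by
    rcases lt_trichotomy m n with hmn | hmn | hmn
    · exact absurd h (hlt m n hmn)
    · exact hmn
    · exact absurd h.symm (hlt n m hmn)
  have hrange : ∀ n i, i ∈ S n → i ∈ Set.range fun n => pick (S n) := by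
    intro n
    induction n with
    | zero => intro i hi; simp [S] at hi
    | succ n ih =>
      intro i hi
      rw [hS, Finset.mem_insert] at hi
      rcases hi with rfl | hi
      · exact ⟨n, rfl⟩
      · exact ih i hi
  refine ⟨fun n => pick (S n), hinj, antitone_nat_of_succ_le fun n => ?_, fun i hi => ?_⟩
  · exact hmax (S n) _ fun h => hpick (S (n + 1)) (hmono n.le_succ h)
  -- If infinitely many entries are positive, zero entries are never picked. An unpicked entry lies
  -- below all picked values, which tend to 0.
  · have hlim : Filter.Tendsto (fun n => r (pick (S n))) Filter.atTop (nhds 0) :=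
      (hs.comp_injective hinj).tendsto_atTop_zero
    exact le_antisymm (ge_of_tendsto' hlim fun n => hmax (S n) i fun h => hi (hrange n i h)) (hr i)

/-! ### Mirsky's inequality -/

theorem trace_add {A B : 𝓗 →L[ℂ] 𝓗} (hA : A.IsPositive) (hB : B.IsPositive) :
    trace (A + B) = trace A + trace B := by
  have h : ∀ {A : 𝓗 →L[ℂ] 𝓗}, A.IsPositive → ∀ x, 0 ≤ (⟪x, A x⟫_ℂ).re := fun hA x =>
    (Complex.le_def.1 (hA.inner_nonneg_right x)).1
  simp only [trace, traceIn, ← ENNReal.tsum_add]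
  refine tsum_congr fun i => ?_
  rw [add_apply, inner_add_right, Complex.add_re,
    ENNReal.ofReal_add (h hA _) (h hB _)]

theorem tsum_ofReal_inner_le_trace {ι : Type*} {A : 𝓗 →L[ℂ] 𝓗} (hA : A.IsPositive) {g : ι → 𝓗}
    (hg : Orthonormal ℂ g) : ∑' i, ENNReal.ofReal (⟪g i, A (g i)⟫_ℂ).re ≤ trace A := by
  obtain ⟨w, b, k, hk, hbk, -⟩ := exists_hilbertBasis_extension_family hg
  rw [trace_eq_traceIn b hA, traceIn]
  simp only [← hbk]
  exact ENNReal.tsum_comp_le_tsum_of_injective hk fun j => ENNReal.ofReal (⟪b j, A (b j)⟫_ℂ).re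

/-- On the span of the first eigenvectors a diagonal operator is bounded below. -/
theorem le_re_inner_sum_of_antitone {r : ℕ → ℝ} {e : ℕ → 𝓗} {ρ : 𝓗 →L[ℂ] 𝓗} (he : Orthonormal ℂ e)
    (hr : Antitone r) (hρ : ∀ i, ρ (e i) = (r i : ℂ) • e i) {n : ℕ} (c : Fin (n + 1) → ℂ) :
    r n * ‖∑ j, c j • e j‖ ^ 2 ≤ (⟪∑ j, c j • e j, ρ (∑ j, c j • e j)⟫_ℂ).re := by
  have he' : Orthonormal ℂ fun j : Fin (n + 1) => e j := he.comp _ Fin.val_injective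
  have h1 : ρ (∑ j, c j • e j) = ∑ j : Fin (n + 1), (c j * r j) • e j := by
    simp only [map_sum, map_smul, hρ, smul_smul]
  have h2 : ‖∑ j, c j • e j‖ ^ 2 = ∑ j, ‖c j‖ ^ 2 := by
    have := he'.inner_sum c c Finset.univ
    rw [inner_self_eq_norm_sq_to_K] at this
    simp only [Complex.conj_mul'] at this
    refine Complex.ofReal_injective ?_
    push_cast
    exact this
  rw [h1, he'.inner_sum c _ Finset.univ, h2, Complex.re_sum, Finset.mul_sum]
  refine Finset.sum_le_sum fun j _ => ?_
  rw [← mul_assoc, Complex.conj_mul', ← Complex.ofReal_pow, ← Complex.ofReal_mul,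
    Complex.ofReal_re, mul_comm]
  exact mul_le_mul_of_nonneg_left (hr (Nat.lt_succ_iff.1 j.2)) (by positivity)

/-- A space of dimension `n + 1` contains a unit vector orthogonal to `n` given vectors. -/
theorem exists_unit_sum_orthogonal {u : ℕ → 𝓗} (hu : Orthonormal ℂ u) (n : ℕ) (g : ℕ → 𝓗) :
    ∃ c : Fin (n + 1) → ℂ, ‖∑ j, c j • u j‖ = 1 ∧ ∀ i < n, ⟪g i, ∑ j, c j • u j⟫_ℂ = 0 := by
  have hu' : Orthonormal ℂ fun j : Fin (n + 1) => u j := hu.comp _ Fin.val_injective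
  let T : (Fin (n + 1) → ℂ) →ₗ[ℂ] (Fin n → ℂ) :=
    LinearMap.pi fun i => (innerSL ℂ (g i)).toLinearMap ∘ₗ
      Fintype.linearCombination ℂ fun j : Fin (n + 1) => u j
  obtain ⟨c, hc, hc0⟩ := (LinearMap.ker T).ne_bot_iff.1
    (LinearMap.ker_ne_bot_of_finrank_lt (f := T) (by simp))
  have hT : ∀ i < n, ⟪g i, ∑ j, c j • u j⟫_ℂ = 0 := fun i hi => congrFun hc ⟨i, hi⟩
  have hx : ∑ j, c j • u j ≠ 0 := fun h => hc0 <| by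
    funext j
    exact Fintype.linearIndependent_iff.1 hu'.linearIndependent c h j
  refine ⟨fun j => ((‖∑ j, c j • u j‖⁻¹ : ℝ) : ℂ) * c j, ?_, fun i hi => ?_⟩
  · simp only [mul_smul, ← Finset.smul_sum]
    rw [norm_smul, Complex.norm_real, norm_inv, norm_norm, inv_mul_cancel₀ (norm_ne_zero_iff.2 hx)]
  · simp only [mul_smul, ← Finset.smul_sum]
    rw [inner_smul_right, hT i hi, mul_zero]

/-- An orthonormal system adapted to a sequence of flags. -/
theorem exists_orthonormal_adapted {u : ℕ → ℕ → 𝓗} (hu : ∀ n, Orthonormal ℂ (u n)) (n : ℕ) :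
    ∃ g : ℕ → 𝓗, Orthonormal ℂ (fun i : Fin n => g i) ∧
      ∀ i < n, ∃ c : Fin (i + 1) → ℂ, g i = ∑ j, c j • u i j := by
  suffices ∃ g : ℕ → 𝓗, (∀ i < n, ‖g i‖ = 1) ∧ (∀ j < n, ∀ i < j, ⟪g i, g j⟫_ℂ = 0) ∧
      ∀ i < n, ∃ c : Fin (i + 1) → ℂ, g i = ∑ j, c j • u i j by
    obtain ⟨g, h1, h2, h3⟩ := this
    refine ⟨g, ⟨fun i => h1 i i.2, fun i j hij => ?_⟩, h3⟩
    rcases lt_or_gt_of_ne (Fin.val_ne_of_ne hij) with h | h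
    · exact h2 j j.2 i h
    · exact inner_eq_zero_symm.1 (h2 i i.2 j h)
  induction n with
  | zero => exact ⟨0, by simp, by simp, by simp⟩
  | succ n ih =>
    obtain ⟨g, h1, h2, h3⟩ := ih
    obtain ⟨c, hc1, hc2⟩ := exists_unit_sum_orthogonal (hu n) n g
    have hne : ∀ i < n, Function.update g n (∑ j, c j • u n j) i = g i := fun i hi =>
      Function.update_of_ne hi.ne _ _
    refine ⟨Function.update g n (∑ j, c j • u n j), ?_, ?_, ?_⟩
    · intro i hi
      rcases Nat.lt_succ_iff_lt_or_eq.1 hi with hi | rfl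
      · rw [hne i hi, h1 i hi]
      · rw [Function.update_self, hc1]
    · intro j hj i hij
      rcases Nat.lt_succ_iff_lt_or_eq.1 hj with hj | rfl
      · rw [hne j hj, hne i (hij.trans hj), h2 j hj i hij]
      · rw [hne i hij, Function.update_self, hc2 i hij]
    · intro i hi
      rcases Nat.lt_succ_iff_lt_or_eq.1 hi with hi | rfl
      · rw [hne i hi]; exact h3 i hi
      · rw [Function.update_self]; exact ⟨c, rfl⟩

/-- Mirsky's inequality: the decreasingly ordered spectra of two density operators are at most as
far apart as the operators are in trace norm. -/
theorem sum_max_le_of_traceNorm {ρ σ : 𝓗 →L[ℂ] 𝓗} (hρ : IsDensityOperator ρ)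
    (hσ : IsDensityOperator σ) {ε : ℝ≥0} (hε : traceNorm (ρ - σ) / 2 = ε) {r s : ℕ → ℝ}
    {e f : ℕ → 𝓗} (he : Orthonormal ℂ e) (hf : Orthonormal ℂ f) (hr : Antitone r) (hs : Antitone s)
    (hr0 : ∀ i, 0 ≤ r i)
    (hρe : ∀ i, ρ (e i) = (r i : ℂ) • e i) (hσf : ∀ i, σ (f i) = (s i : ℂ) • f i) (n : ℕ) :
    ∑ i ∈ Finset.range n, max (r i) (s i) ≤ 1 + ε := by
  have hDsa : IsSelfAdjoint (ρ - σ) := hρ.1.isSelfAdjoint.sub hσ.1.isSelfAdjoint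
  set D := CFC.abs (ρ - σ) with hD
  have hDpos : D.IsPositive :=
    (ContinuousLinearMap.nonneg_iff_isPositive _).1 (CFC.abs_nonneg (ρ - σ))
  -- `M` dominates both 2ρ and 2σ, the differences being twice the negative and positive parts of ρ
  -- - σ, and its trace is only 2(1 + ε).
  set M := ρ + σ + D with hM
  have hMpos : M.IsPositive := (hρ.1.add hσ.1).add hDpos
  have hnorm : trace D = 2 * ε := by
    rw [← hε, ENNReal.mul_div_cancel two_ne_zero ENNReal.ofNat_ne_top]
    rfl
  have htr : trace M = ENNReal.ofReal (2 * (1 + ε)) := by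
    rw [hM, trace_add (hρ.1.add hσ.1) hDpos, trace_add hρ.1 hσ.1, hρ.2, hσ.2, hnorm,
      ENNReal.ofReal_mul zero_le_two, ENNReal.ofReal_add zero_le_one ε.coe_nonneg]
    simp only [ENNReal.ofReal_ofNat, ENNReal.ofReal_one, ENNReal.ofReal_coe_nnreal]
    ring
  have hMρ : (M - (ρ + ρ)).IsPositive := by
    have h : M - (ρ + ρ) = D - (ρ - σ) := by rw [hM]; abel
    rw [h, hD, CFC.abs_sub_self _ hDsa, ← ContinuousLinearMap.nonneg_iff_isPositive]
    exact nsmul_nonneg (CFC.negPart_nonneg _) 2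
  have hMσ : (M - (σ + σ)).IsPositive := by
    have h : M - (σ + σ) = D + (ρ - σ) := by rw [hM]; abel
    rw [h, hD, CFC.abs_add_self _ hDsa, ← ContinuousLinearMap.nonneg_iff_isPositive]
    exact nsmul_nonneg (CFC.posPart_nonneg _) 2
  have hle : ∀ {A : 𝓗 →L[ℂ] 𝓗}, (M - (A + A)).IsPositive → ∀ x,
      2 * (⟪x, A x⟫_ℂ).re ≤ (⟪x, M x⟫_ℂ).re := fun hA x => by
    have := (Complex.le_def.1 (hA.inner_nonneg_right x)).1
    simp only [sub_apply, add_apply, inner_sub_right,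
      inner_add_right, Complex.sub_re, Complex.add_re, Complex.zero_re] at this
    linarith
  -- At place `i` the flag of the operator with the larger `i`-th eigenvalue is used; a unit vector
  -- in the span of its first `i + 1` eigenvectors sees at least that eigenvalue.
  obtain ⟨g, hg, hgc⟩ := exists_orthonormal_adapted (u := fun i => if s i ≤ r i then e else f)
    (fun i => by split_ifs <;> assumption) n
  have hmax : ∀ i : Fin n, 2 * max (r i) (s i) ≤ (⟪g i, M (g i)⟫_ℂ).re := fun i => by
    obtain ⟨c, hc⟩ := hgc i i.2
    have h1 := hg.norm_eq_one i
    by_cases hi : s i ≤ r i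
    · simp only [if_pos hi] at hc
      have := le_re_inner_sum_of_antitone he hr hρe c
      rw [← hc, h1] at this
      rw [max_eq_left hi]
      linarith [hle hMρ (g i)]
    · simp only [if_neg hi] at hc
      have := le_re_inner_sum_of_antitone hf hs hσf c
      rw [← hc, h1] at this
      rw [max_eq_right (not_le.1 hi).le]
      linarith [hle hMσ (g i)]
  have hsum : ENNReal.ofReal (∑ i : Fin n, 2 * max (r i) (s i)) ≤
      ENNReal.ofReal (2 * (1 + ε)) := by
    rw [← htr, ENNReal.ofReal_sum_of_nonneg fun i _ =>
      mul_nonneg zero_le_two (le_max_of_le_left (hr0 _)), ← tsum_fintype (L := .unconditional _)]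
    exact (ENNReal.tsum_le_tsum fun i => ENNReal.ofReal_le_ofReal (hmax i)).trans
      (tsum_ofReal_inner_le_trace hMpos hg)
  rw [ENNReal.ofReal_le_ofReal_iff (by positivity), ← Finset.mul_sum] at hsum
  rw [Finset.sum_range fun i => max (r i) (s i)]
  linarith

/-! ### Continuity of the Shannon entropy -/

theorem summable_and_tsum_le_of_tsum_ofReal_le {ι : Type*} {f : ι → ℝ} (hf : ∀ i, 0 ≤ f i) {L : ℝ}
    (hL : 0 ≤ L) (h : ∑' i, ENNReal.ofReal (f i) ≤ ENNReal.ofReal L) :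
    Summable f ∧ ∑' i, f i ≤ L := by
  have hs : ∀ s : Finset ι, ∑ i ∈ s, f i ≤ L := fun s => by
    rw [← ENNReal.ofReal_le_ofReal_iff hL, ENNReal.ofReal_sum_of_nonneg fun i _ => hf i]
    exact (ENNReal.sum_le_tsum s).trans h
  exact ⟨summable_of_sum_le hf hs, Real.tsum_le_of_sum_le hf hs⟩

theorem negMulLog_add_le {a b : ℝ} (ha : 0 ≤ a) (hb : 0 ≤ b) :
    Real.negMulLog (a + b) ≤ Real.negMulLog a + Real.negMulLog b := by
  rcases ha.eq_or_lt with rfl | ha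
  · simp
  rcases hb.eq_or_lt with rfl | hb
  · simp
  have h1 : a * Real.log a ≤ a * Real.log (a + b) :=
    mul_le_mul_of_nonneg_left (Real.log_le_log ha (by linarith)) ha.le
  have h2 : b * Real.log b ≤ b * Real.log (a + b) :=
    mul_le_mul_of_nonneg_left (Real.log_le_log hb (by linarith)) hb.le
  simp only [Real.negMulLog]
  linarith

/-- Concavity at q = (1 - δ) · m/(1 - δ) + δ · (q - m)/δ; the second term is dropped, being
nonnegative because (q - m)/δ ≤ 1. -/
theorem negMulLog_sub_mul_log_le {m q δ : ℝ} (hm : 0 ≤ m) (hmq : m ≤ q) (hq : q - m ≤ δ)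
    (hδ0 : 0 < δ) (hδ1 : δ < 1) :
    Real.negMulLog m + m * Real.log (1 - δ) ≤ Real.negMulLog q := by
  have hδ : 0 < 1 - δ := sub_pos.2 hδ1
  have hu : 0 ≤ (q - m) / δ := div_nonneg (sub_nonneg.2 hmq) hδ0.le
  have h := Real.concaveOn_negMulLog.2 (x := m / (1 - δ)) (y := (q - m) / δ)
    (div_nonneg hm hδ.le) hu hδ.le hδ0.le (by ring)
  simp only [smul_eq_mul] at h
  rw [mul_div_cancel₀ _ hδ.ne', mul_div_cancel₀ _ hδ0.ne', add_sub_cancel] at h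
  have h2 := mul_nonneg hδ0.le (Real.negMulLog_nonneg hu ((div_le_one hδ0).2 hq))
  have h3 : (1 - δ) * Real.negMulLog (m / (1 - δ)) = Real.negMulLog m + m * Real.log (1 - δ) := by
    rcases hm.eq_or_lt with rfl | hm
    · simp
    rw [Real.negMulLog, Real.log_div hm.ne' hδ.ne', Real.negMulLog]
    field_simp
    ring
  linarith

/-- Continuity of the Shannon entropy: the entropies of two distributions with total variation
distance `δ` differ by at most `h(δ) + δ H(t)`, where `t` is the normalized positive part of their
difference. -/
theorem tsum_negMulLog_sub_le {p q : ℕ → ℝ} (hp0 : ∀ i, 0 ≤ p i) (hq0 : ∀ i, 0 ≤ q i)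
    (hp : HasSum p 1) (hq : HasSum q 1) {δ : ℝ} (hδ0 : 0 < δ)
    (hδ : HasSum (fun i => max (p i) (q i) - q i) δ)
    (hηp : Summable fun i => Real.negMulLog (p i)) (hηq : Summable fun i => Real.negMulLog (q i))
    (hηt : Summable fun i => Real.negMulLog ((max (p i) (q i) - q i) / δ)) :
    ∑' i, Real.negMulLog (p i) - ∑' i, Real.negMulLog (q i) ≤
      Real.binEntropy δ + δ * ∑' i, Real.negMulLog ((max (p i) (q i) - q i) / δ) := by
  have hmin : ∀ i, min (p i) (q i) = p i - (max (p i) (q i) - q i) := fun i => by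
    linarith [min_add_max (p i) (q i)]
  have hm : HasSum (fun i => min (p i) (q i)) (1 - δ) := by
    simp only [hmin]
    exact hp.sub hδ
  have hm0 : ∀ i, 0 ≤ min (p i) (q i) := fun i => le_min (hp0 i) (hq0 i)
  have hu : ∀ i, q i - min (p i) (q i) ≤ δ := fun i => by
    have h := hq.sub hm
    rw [sub_sub_cancel] at h
    exact le_hasSum h i fun j _ => sub_nonneg.2 (min_le_right _ _)
  have hδ1 : δ ≤ 1 := sub_nonneg.1 (hm.nonneg hm0)
  -- With η(x) = -x log x, the three ingredients are subadditivity of η for p = min(p, q) + δt, the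
  -- product rule for η(δt), and the comparison of η(min(p, q)) with η(q). Summed over `i`, the
  -- terms in log(1 - δ) and η(δ) make up h(δ).
  have hpt : ∀ i, Real.negMulLog (p i) ≤ Real.negMulLog (q i) -
      min (p i) (q i) * Real.log (1 - δ) + ((max (p i) (q i) - q i) / δ * Real.negMulLog δ +
        δ * Real.negMulLog ((max (p i) (q i) - q i) / δ)) := fun i => by
    have h1 : Real.negMulLog (p i) ≤
        Real.negMulLog (min (p i) (q i)) + Real.negMulLog (max (p i) (q i) - q i) := by
      have := negMulLog_add_le (hm0 i) (sub_nonneg.2 (le_max_right (p i) (q i)))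
      rwa [hmin, sub_add_cancel, ← hmin] at this
    have h2 : Real.negMulLog (max (p i) (q i) - q i) =
        (max (p i) (q i) - q i) / δ * Real.negMulLog δ +
          δ * Real.negMulLog ((max (p i) (q i) - q i) / δ) := by
      rw [← Real.negMulLog_mul, mul_div_cancel₀ _ hδ0.ne']
    have h3 : Real.negMulLog (min (p i) (q i)) ≤
        Real.negMulLog (q i) - min (p i) (q i) * Real.log (1 - δ) := by
      -- For δ = 1 the overlap min(p, q) vanishes identically, so the value of `Real.log 0` is
      -- harmless.
      rcases hδ1.eq_or_lt with rfl | hδ1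
      · rw [sub_self] at hm
        have := congrFun ((hasSum_zero_iff_of_nonneg hm0).1 hm) i
        simp only [Pi.zero_apply] at this
        rw [this]
        simpa using Real.negMulLog_nonneg (hq0 i) (le_hasSum hq i fun j _ => hq0 j)
      · linarith [negMulLog_sub_mul_log_le (hm0 i) (min_le_right (p i) (q i)) (hu i) hδ0 hδ1]
    linarith
  have hsum := (hηq.hasSum.sub (hm.mul_right (Real.log (1 - δ)))).add
    (((hδ.div_const δ).mul_right (Real.negMulLog δ)).add (hηt.hasSum.mul_left δ))
  have h := hasSum_le hpt hηp.hasSum hsum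
  rw [div_self hδ0.ne', one_mul] at h
  rw [Real.binEntropy_eq_negMulLog_add_negMulLog_one_sub, Real.negMulLog.eq_def (1 - δ)]
  linarith

/-- `hvar` is used twice: for `r` itself and for the normalized positive part of r - s, whose
support lies in that of `r`. -/
theorem tsum_negMulLog_sub_le_of_sum_max_le {r s : ℕ → ℝ} (hr0 : ∀ i, 0 ≤ r i) (hs0 : ∀ i, 0 ≤ s i)
    (hr : HasSum r 1) (hs : HasSum s 1) {ε L : ℝ} (hε0 : 0 ≤ ε) (hε1 : ε ≤ 1) (hL : 0 ≤ L)
    (hmax : ∀ n, ∑ i ∈ Finset.range n, max (r i) (s i) ≤ 1 + ε)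
    (hηs : Summable fun i => Real.negMulLog (s i))
    (hvar : ∀ p : ℕ → ℝ, (∀ i, 0 ≤ p i) → HasSum p 1 → (∀ i, p i ≠ 0 → r i ≠ 0) →
      ∑' i, ENNReal.ofReal (Real.negMulLog (p i)) ≤ ENNReal.ofReal L) :
    ∑' i, Real.negMulLog (r i) - ∑' i, Real.negMulLog (s i) ≤ 2 * ε * L + Real.binEntropy ε := by
  have hη0 : ∀ {p : ℕ → ℝ}, (∀ i, 0 ≤ p i) → HasSum p 1 → ∀ i, 0 ≤ Real.negMulLog (p i) :=
    fun hp0 hp i => Real.negMulLog_nonneg (hp0 i) (le_hasSum hp i fun j _ => hp0 j)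
  have hvar' : ∀ p : ℕ → ℝ, (∀ i, 0 ≤ p i) → HasSum p 1 → (∀ i, p i ≠ 0 → r i ≠ 0) →
      (Summable fun i => Real.negMulLog (p i)) ∧ ∑' i, Real.negMulLog (p i) ≤ L :=
    fun p hp0 hp hpr => summable_and_tsum_le_of_tsum_ofReal_le (hη0 hp0 hp) hL (hvar p hp0 hp hpr)
  obtain ⟨hηr, hrL⟩ := hvar' r hr0 hr fun i => id
  have hs_nonneg : 0 ≤ ∑' i, Real.negMulLog (s i) := tsum_nonneg (hη0 hs0 hs)
  have hh : 0 ≤ Real.binEntropy ε := Real.binEntropy_nonneg hε0 hε1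
  -- For ε ≥ 1/2 the entropy of `r` is at most L ≤ 2εL. Otherwise δ ≤ ε ≤ 1/2 lies where the binary
  -- entropy increases.
  rcases le_total 2⁻¹ ε with hε | hε
  · nlinarith
  have hmaxs : Summable fun i => max (r i) (s i) :=
    summable_of_sum_range_le (fun i => le_max_of_le_left (hr0 i)) hmax
  have hδ := hmaxs.hasSum.sub hs
  set δ := ∑' i, max (r i) (s i) - 1 with hδdef
  have ht0 : ∀ i, 0 ≤ max (r i) (s i) - s i := fun i => sub_nonneg.2 (le_max_right _ _)
  have hδ0 : 0 ≤ δ := hδ.nonneg ht0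
  have hδε : δ ≤ ε := by
    have := Real.tsum_le_of_sum_range_le (fun i => le_max_of_le_left (hr0 i)) hmax
    linarith
  rcases hδ0.eq_or_lt with h0 | hδpos
  · have hle : ∀ i, r i ≤ s i := fun i => by
      rw [← h0] at hδ
      have := congrFun ((hasSum_zero_iff_of_nonneg ht0).1 hδ) i
      simp only [Pi.zero_apply] at this
      linarith [le_max_left (r i) (s i)]
    have heq : r = s := by
      have h := hs.sub hr
      rw [sub_self] at h
      funext i
      have := congrFun ((hasSum_zero_iff_of_nonneg fun i => sub_nonneg.2 (hle i)).1 h) i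
      simp only [Pi.zero_apply] at this
      linarith
    rw [heq, sub_self]
    positivity
  · have ht1 : HasSum (fun i => (max (r i) (s i) - s i) / δ) 1 := by
      have := hδ.div_const δ
      rwa [div_self hδpos.ne'] at this
    obtain ⟨hηt, htL⟩ := hvar' _ (fun i => div_nonneg (ht0 i) hδ0) ht1 fun i hi hri => hi <| by
      rw [hri, max_eq_right (hs0 i), sub_self, zero_div]
    have h1 := tsum_negMulLog_sub_le hr0 hs0 hr hs hδpos hδ hηr hηs hηt
    have h2 : Real.binEntropy δ ≤ Real.binEntropy ε :=
      Real.binEntropy_strictMonoOn.monotoneOn ⟨hδ0, hδε.trans hε⟩ ⟨hε0, hε⟩ hδε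
    have h3 := mul_le_mul hδε htL (tsum_nonneg (hη0 (fun i => div_nonneg (ht0 i) hδ0) ht1)) hε0
    nlinarith [mul_nonneg hε0 hL]

/-! ### Gibbs variational principle -/

theorem tsum_ofReal_norm_inner_sq_le {ι : Type*} {e : ι → 𝓗} (he : Orthonormal ℂ e) (x : 𝓗) :
    ∑' i, ENNReal.ofReal (‖⟪x, e i⟫_ℂ‖ ^ 2) ≤ ENNReal.ofReal (‖x‖ ^ 2) := by
  obtain ⟨w, b, k, hk, hbk, -⟩ := exists_hilbertBasis_extension_family he
  rw [← tsum_enorm_sq b]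
  simp only [← hbk, norm_inner_symm x]
  exact ENNReal.tsum_comp_le_tsum_of_injective hk fun j => ENNReal.ofReal (‖⟪b j, x⟫_ℂ‖ ^ 2)

/-- This is log x ≤ x - 1 at x = g/p, the pointwise form of nonnegativity of relative entropy. For p
≤ 1 and g ≤ 1 all terms are nonnegative, so it can be summed in [0, ∞]. -/
theorem negMulLog_add_self_le {p g : ℝ} (hp : 0 < p) (hg : 0 < g) :
    Real.negMulLog p + p ≤ p * -Real.log g + g := by
  have h := mul_le_mul_of_nonneg_left (Real.log_le_sub_one_of_pos (div_pos hg hp)) hp.le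
  rw [Real.log_div hg.ne' hp.ne', mul_sub, mul_sub, mul_div_cancel₀ _ hp.ne'] at h
  rw [Real.negMulLog]
  linarith

/-- The Gibbs variational principle: if the pure states occurring in an orthonormal mixture have
mean surprisal at most `L` with respect to a distribution `g` on an orthonormal basis, then the
entropy of the mixture is at most `L`. -/
theorem tsum_ofReal_negMulLog_le (b : HilbertBasis ℕ ℂ 𝓗) {e : ℕ → 𝓗} (he : Orthonormal ℂ e)
    {p g : ℕ → ℝ} (hp0 : ∀ i, 0 ≤ p i) (hp : HasSum p 1) (hg0 : ∀ n, 0 ≤ g n) (hg : HasSum g 1)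
    {L : ℝ} (hsupp : ∀ i, p i ≠ 0 → ∀ n, ⟪b n, e i⟫_ℂ ≠ 0 → g n ≠ 0)
    (hL : ∀ i, p i ≠ 0 →
      ∑' n, ENNReal.ofReal (‖⟪b n, e i⟫_ℂ‖ ^ 2 * -Real.log (g n)) ≤ ENNReal.ofReal L) :
    ∑' i, ENNReal.ofReal (Real.negMulLog (p i)) ≤ ENNReal.ofReal L := by
  have hone : ∀ {p : ℕ → ℝ}, (∀ i, 0 ≤ p i) → HasSum p 1 → ∑' i, ENNReal.ofReal (p i) = 1 := by
    intro p hp0 hp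
    rw [← ENNReal.ofReal_tsum_of_nonneg hp0 hp.summable, hp.tsum_eq, ENNReal.ofReal_one]
  -- The transition matrix is doubly substochastic: rows sum to 1 by Parseval, columns to at most 1
  -- by Bessel, as `e` need not be complete.
  set q : ℕ → ℕ → ℝ≥0∞ := fun i n => ENNReal.ofReal (‖⟪b n, e i⟫_ℂ‖ ^ 2) with hq
  have hq1 : ∀ i, ∑' n, q i n = 1 := fun i => by
    rw [tsum_enorm_sq b, he.norm_eq_one, one_pow, ENNReal.ofReal_one]
  have hq2 : ∀ n, ∑' i, q i n ≤ 1 := fun n => by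
    refine (tsum_ofReal_norm_inner_sq_le he (b n)).trans ?_
    rw [b.orthonormal.norm_eq_one, one_pow, ENNReal.ofReal_one]
  have hη : ∀ i, 0 ≤ Real.negMulLog (p i) := fun i =>
    Real.negMulLog_nonneg (hp0 i) (le_hasSum hp i fun j _ => hp0 j)
  have hlog : ∀ n, 0 ≤ -Real.log (g n) := fun n =>
    neg_nonneg.2 (Real.log_nonpos (hg0 n) (le_hasSum hg n fun j _ => hg0 j))
  have hpt : ∀ i n, q i n * ENNReal.ofReal (Real.negMulLog (p i) + p i) ≤
      ENNReal.ofReal (p i) * ENNReal.ofReal (‖⟪b n, e i⟫_ℂ‖ ^ 2 * -Real.log (g n)) +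
        q i n * ENNReal.ofReal (g n) := fun i n => by
    rcases (hp0 i).eq_or_lt with hpi | hpi
    · simp [← hpi]
    by_cases hz : ⟪b n, e i⟫_ℂ = 0
    · simp [hq, hz]
    -- The surprisal at g n = 0 should be ∞ but reads 0 here; `hsupp` excludes this case.
    have hgn : 0 < g n := (hg0 n).lt_of_ne' (hsupp i hpi.ne' n hz)
    rw [hq, ← ENNReal.ofReal_mul (sq_nonneg _), ← ENNReal.ofReal_mul hpi.le,
      ← ENNReal.ofReal_mul (sq_nonneg _), ← ENNReal.ofReal_add
        (mul_nonneg hpi.le (mul_nonneg (sq_nonneg _) (hlog n)))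
        (mul_nonneg (sq_nonneg _) hgn.le)]
    refine ENNReal.ofReal_le_ofReal ?_
    have := mul_le_mul_of_nonneg_left (negMulLog_add_self_le hpi hgn) (sq_nonneg ‖⟪b n, e i⟫_ℂ‖)
    linarith
  have hi : ∀ i, ENNReal.ofReal (Real.negMulLog (p i)) + ENNReal.ofReal (p i) ≤
      ENNReal.ofReal (p i) * ENNReal.ofReal L + ∑' n, q i n * ENNReal.ofReal (g n) := fun i => by
    have h := ENNReal.tsum_le_tsum (hpt i)
    rw [ENNReal.tsum_mul_right, hq1, one_mul, ENNReal.tsum_add, ENNReal.tsum_mul_left,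
      ENNReal.ofReal_add (hη i) (hp0 i)] at h
    refine h.trans (add_le_add ?_ le_rfl)
    by_cases hpi : p i = 0
    · simp [hpi]
    · exact mul_le_mul_right (hL i hpi) _
  have h := ENNReal.tsum_le_tsum hi
  rw [ENNReal.tsum_add, ENNReal.tsum_add, ENNReal.tsum_mul_right, hone hp0 hp, one_mul,
    ENNReal.tsum_comm] at h
  simp only [ENNReal.tsum_mul_right] at h
  have h2 : ∑' n, (∑' i, q i n) * ENNReal.ofReal (g n) ≤ 1 := by
    rw [← hone hg0 hg]
    exact ENNReal.tsum_le_tsum fun n => mul_le_of_le_one_left' (hq2 n)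
  -- The added terms total 1 = ∑ pᵢ on the left and at most 1 on the right, and cancel.
  exact ENNReal.le_of_add_le_add_right ENNReal.one_ne_top (h.trans (add_le_add le_rfl h2))

/-! ### Thermal states -/

namespace Hamiltonian

variable (H : Hamiltonian 𝓗)

theorem level_nonneg (n : ℕ) : 0 ≤ H.level n := H.ground.2 ⟨n, rfl⟩

theorem re_inner_ketBra (x ψ : 𝓗) : (⟪x, ketBra ψ x⟫_ℂ).re = ‖⟪x, ψ⟫_ℂ‖ ^ 2 := by
  rw [ketBra_apply, inner_smul_right, ← inner_conj_symm ψ, Complex.conj_mul', ← Complex.ofReal_pow,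
    Complex.ofReal_re]

theorem energy_ketBra_eq_tsum (ψ : 𝓗) : H.energy (ketBra ψ) =
    ∑' n, ENNReal.ofReal (H.level n) * ENNReal.ofReal (‖⟪H.basis n, ψ⟫_ℂ‖ ^ 2) := by
  simp only [energy, re_inner_ketBra, ENNReal.ofReal_mul (H.level_nonneg _)]

section DiagonalState

variable {w : ℕ → ℝ}

theorem hasSum_diagonalState (hw0 : ∀ n, 0 ≤ w n) (hw : Summable w) :
    HasSum (fun n => ((w n / ∑' m, w m : ℝ) : ℂ) • ketBra (H.basis n)) (H.diagonalState w) := by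
  refine (Summable.of_norm ?_).hasSum
  refine (hw.div_const (∑' m, w m)).congr fun n => ?_
  rw [norm_smul, ketBra, InnerProductSpace.norm_rankOne, H.basis.orthonormal.norm_eq_one,
    Complex.norm_real, Real.norm_of_nonneg (div_nonneg (hw0 n) (tsum_nonneg hw0))]
  simp

theorem energy_diagonalState (hw0 : ∀ n, 0 ≤ w n) (hw : Summable w) :
    H.energy (H.diagonalState w) =
      ∑' n, ENNReal.ofReal (H.level n) * ENNReal.ofReal (w n / ∑' m, w m) := by
  refine tsum_congr fun n => ?_
  rw [apply_eq_of_hasSum_ketBra H.basis.orthonormal (H.hasSum_diagonalState hw0 hw),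
    inner_smul_right, inner_self_eq_norm_sq_to_K, H.basis.orthonormal.norm_eq_one,
    ← ENNReal.ofReal_mul (H.level_nonneg n)]
  simp

/-- States with Boltzmann weights on their support bound the entropy of all mixtures of pure states
with at most their energy. -/
theorem exists_bound_of_diagonalState (hw0 : ∀ n, 0 ≤ w n) (hw : Summable w) (hw1 : 1 ≤ ∑' n, w n)
    {β : ℝ} (hβ : 0 ≤ β) (hlog : ∀ n, w n ≠ 0 → Real.log (w n) = -(β * H.level n)) {E : ℝ≥0}
    (hE : H.energy (H.diagonalState w) = E)
    (hsupp : ∀ ψ, H.energy (ketBra ψ) ≤ E → ∀ n, ⟪H.basis n, ψ⟫_ℂ ≠ 0 → w n ≠ 0) :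
    ∃ L : ℝ, 0 ≤ L ∧ entropy (H.diagonalState w) = ENNReal.ofReal (L / Real.log 2) ∧
      ∀ (p : ℕ → ℝ) (e : ℕ → 𝓗), Orthonormal ℂ e → (∀ i, 0 ≤ p i) → HasSum p 1 →
        (∀ i, p i ≠ 0 → H.energy (ketBra (e i)) ≤ E) →
        ∑' i, ENNReal.ofReal (Real.negMulLog (p i)) ≤ ENNReal.ofReal L := by
  set Z := ∑' n, w n with hZ
  have hZ0 : 0 < Z := zero_lt_one.trans_le hw1
  have hlogZ : 0 ≤ Real.log Z := Real.log_nonneg hw1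
  have hlog2 : 0 < Real.log 2 := Real.log_pos one_lt_two
  have hg0 : ∀ n, 0 ≤ w n / Z := fun n => div_nonneg (hw0 n) hZ0.le
  have hg1 : HasSum (fun n => w n / Z) 1 := by
    have := hw.hasSum.div_const Z
    rwa [div_self hZ0.ne'] at this
  have hlogg : ∀ n, w n ≠ 0 → -Real.log (w n / Z) = β * H.level n + Real.log Z := fun n hn => by
    rw [Real.log_div hn hZ0.ne', hlog n hn]
    ring
  -- The surprisal is affine in the level, so averaging it gives β times the energy plus log Z.
  have hterm : ∀ (a : ℝ) (n : ℕ), 0 ≤ a → (a ≠ 0 → w n ≠ 0) →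
      ENNReal.ofReal (a * -Real.log (w n / Z)) =
        ENNReal.ofReal β * (ENNReal.ofReal (H.level n) * ENNReal.ofReal a) +
          ENNReal.ofReal (Real.log Z) * ENNReal.ofReal a := fun a n ha han => by
    rcases eq_or_ne a 0 with rfl | ha0
    · simp
    have h1 := H.level_nonneg n
    rw [hlogg n (han ha0), ← ENNReal.ofReal_mul h1, ← ENNReal.ofReal_mul hβ,
      ← ENNReal.ofReal_mul hlogZ, ← ENNReal.ofReal_add (by positivity) (by positivity)]
    congr 1
    ring
  have hLE : ENNReal.ofReal (β * E + Real.log Z) =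
      ENNReal.ofReal β * E + ENNReal.ofReal (Real.log Z) := by
    rw [ENNReal.ofReal_add (by positivity) hlogZ, ENNReal.ofReal_mul hβ,
      ENNReal.ofReal_coe_nnreal]
  -- This value is the entropy of the diagonal state in natural units, and bounds the mean surprisal
  -- of every pure state of energy at most E.
  refine ⟨β * E + Real.log Z, by positivity, ?_, ?_⟩
  · have h1 : ∀ n, ENNReal.ofReal (negMulLogTwo (w n / Z)) =
        ENNReal.ofReal (w n / Z * -Real.log (w n / Z)) * ENNReal.ofReal (Real.log 2)⁻¹ :=
      fun n => by
        rw [← ENNReal.ofReal_mul' (by positivity), negMulLogTwo, Real.negMulLog, div_eq_mul_inv]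
        congr 1
        ring
    rw [entropy_eq_tsum H.basis.orthonormal hg0 hg1 (H.hasSum_diagonalState hw0 hw)]
    simp only [h1]
    rw [ENNReal.tsum_mul_right, div_eq_mul_inv, ENNReal.ofReal_mul' (by positivity), hLE]
    congr 1
    rw [tsum_congr fun n => hterm (w n / Z) n (hg0 n) fun h h0 => h (by rw [h0, zero_div]),
      ENNReal.tsum_add, ENNReal.tsum_mul_left, ENNReal.tsum_mul_left,
      ← H.energy_diagonalState hw0 hw, hE, ← ENNReal.ofReal_tsum_of_nonneg hg0 hg1.summable,
      hg1.tsum_eq, ENNReal.ofReal_one, mul_one]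
  · intro p e he hp0 hp hpE
    refine tsum_ofReal_negMulLog_le H.basis he hp0 hp hg0 hg1
      (fun i hi n hn => div_ne_zero (hsupp _ (hpE i hi) n hn) hZ0.ne') fun i hi => ?_
    rw [tsum_congr fun n => hterm (‖⟪H.basis n, e i⟫_ℂ‖ ^ 2) n (sq_nonneg _) fun h =>
        hsupp _ (hpE i hi) n fun h0 => h (by rw [h0, norm_zero, zero_pow two_ne_zero]),
      ENNReal.tsum_add, ENNReal.tsum_mul_left, ENNReal.tsum_mul_left, ← H.energy_ketBra_eq_tsum,
      tsum_enorm_sq, he.norm_eq_one, one_pow, ENNReal.ofReal_one, mul_one, hLE]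
    exact add_le_add (mul_le_mul_right (hpE i hi) _) le_rfl

end DiagonalState

/-- The ground state is treated with β = 0 and indicator weights: vectors of energy 0 have no
component outside the ground space. In both cases Z ≥ 1 because the level 0 occurs. -/
theorem IsThermalState.exists_bound {H : Hamiltonian 𝓗} (hH : H.GibbsHypothesis) {E : ℝ≥0}
    {γ : 𝓗 →L[ℂ] 𝓗} (hγ : H.IsThermalState E γ) :
    ∃ L : ℝ, 0 ≤ L ∧ entropy γ = ENNReal.ofReal (L / Real.log 2) ∧
      ∀ (p : ℕ → ℝ) (e : ℕ → 𝓗), Orthonormal ℂ e → (∀ i, 0 ≤ p i) → HasSum p 1 →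
        (∀ i, p i ≠ 0 → H.energy (ketBra (e i)) ≤ E) →
        ∑' i, ENNReal.ofReal (Real.negMulLog (p i)) ≤ ENNReal.ofReal L := by
  obtain ⟨⟨n₀, hn₀⟩, -⟩ := H.ground
  rcases hγ with ⟨β, hβ, rfl, hE⟩ | ⟨rfl, rfl⟩
  · have hw0 : ∀ n, 0 ≤ Real.exp (-β * H.level n) := fun n => (Real.exp_pos _).le
    refine H.exists_bound_of_diagonalState hw0 (hH β hβ) ?_ hβ.le (fun n _ => ?_) hE
      fun _ _ n _ => (Real.exp_pos _).ne'
    · have := (hH β hβ).le_tsum n₀ fun n _ => hw0 n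
      rwa [hn₀, mul_zero, Real.exp_zero] at this
    · rw [Real.log_exp, neg_mul]
  · classical
    have hw0 : ∀ n, 0 ≤ if H.level n = 0 then (1 : ℝ) else 0 := fun n => by
      split_ifs <;> norm_num
    have hw : Summable fun n => if H.level n = 0 then (1 : ℝ) else 0 := by
      refine summable_of_hasFiniteSupport ((Filter.eventually_cofinite.1
        (H.discrete.eventually_gt_atTop 0)).subset fun n hn => ?_)
      have : H.level n = 0 := by
        by_contra h
        simp [h] at hn
      simp [this]
    have hdef : H.groundState = H.diagonalState fun n => if H.level n = 0 then 1 else 0 := by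
      unfold groundState
      congr!
    rw [hdef]
    refine H.exists_bound_of_diagonalState hw0 hw ?_ le_rfl (fun n hn => ?_) ?_
      fun ψ hψ n hn h => ?_
    · have := hw.le_tsum n₀ fun n _ => hw0 n
      rwa [if_pos hn₀] at this
    · by_cases h : H.level n = 0
      · simp [h]
      · simp [h] at hn
    · rw [H.energy_diagonalState hw0 hw, ENNReal.coe_zero, ENNReal.tsum_eq_zero]
      intro n
      by_cases h : H.level n = 0 <;> simp [h]
    · rw [H.energy_ketBra_eq_tsum, ENNReal.coe_zero, nonpos_iff_eq_zero,
        ENNReal.tsum_eq_zero] at hψ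
      have hl : H.level n ≠ 0 := fun hl => by simp [hl] at h
      rcases mul_eq_zero.1 (hψ n) with h1 | h1
      · exact hl (le_antisymm (ENNReal.ofReal_eq_zero.1 h1) (H.level_nonneg n))
      · rw [ENNReal.ofReal_eq_zero] at h1
        exact hn (norm_eq_zero.1 (pow_eq_zero_iff two_ne_zero |>.1
          (le_antisymm h1 (sq_nonneg _))))

/-- The spectral decomposition can be chosen with decreasing eigenvalues. -/
theorem IsMixtureOfEnergyLE.exists_antitone {H : Hamiltonian 𝓗} {E : ℝ≥0} {ρ : 𝓗 →L[ℂ] 𝓗}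
    (hρ : H.IsMixtureOfEnergyLE E ρ) :
    ∃ (r : ℕ → ℝ) (e : ℕ → 𝓗), Antitone r ∧ Orthonormal ℂ e ∧ (∀ i, 0 ≤ r i) ∧ HasSum r 1 ∧
      (∀ i, r i ≠ 0 → H.energy (ketBra (e i)) ≤ E) ∧
      HasSum (fun i => (r i : ℂ) • ketBra (e i)) ρ := by
  obtain ⟨r, e, he, hr0, hr, hE, hsum⟩ := hρ
  obtain ⟨a, ha, hanti, h0⟩ := exists_antitone_rearrangement hr0 hr.summable
  refine ⟨r ∘ a, e ∘ a, hanti, he.comp a ha, fun i => hr0 _, (ha.hasSum_iff h0).2 hr,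
    fun i => hE (a i), ?_⟩
  refine (ha.hasSum_iff (f := fun i => (r i : ℂ) • ketBra (e i)) fun i hi => ?_).2 hsum
  simp [h0 i hi]

end Hamiltonian

end EntropyBound

/-! ### The entropy bound -/

theorem proposition2 {𝓗 : Type*} [NormedAddCommGroup 𝓗] [InnerProductSpace ℂ 𝓗] [CompleteSpace 𝓗]
    (H : EntropyBound.Hamiltonian 𝓗) (hH : H.GibbsHypothesis)
    (E : ℝ≥0) (γ : 𝓗 →L[ℂ] 𝓗) (hγ : H.IsThermalState E γ)
    (ρ σ : 𝓗 →L[ℂ] 𝓗)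
    (hρ : EntropyBound.IsDensityOperator ρ) (hσ : EntropyBound.IsDensityOperator σ)
    (hρE : H.IsMixtureOfEnergyLE E ρ) (hσE : H.IsMixtureOfEnergyLE E σ)
    (ε : ℝ≥0) (hε : EntropyBound.traceNorm (ρ - σ) / 2 = ε) (hε1 : ε ≤ 1) :
    EntropyBound.entropy γ ≠ ∞ ∧ EntropyBound.entropy ρ ≠ ∞ ∧ EntropyBound.entropy σ ≠ ∞ ∧
      |(EntropyBound.entropy ρ).toReal - (EntropyBound.entropy σ).toReal| ≤
        2 * ε * (EntropyBound.entropy γ).toReal + EntropyBound.binaryEntropy ε := by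
  obtain ⟨L, hL, hγL, hvar⟩ := hγ.exists_bound hH
  obtain ⟨r, e, hra, he, hr0, hr, hrE, hre⟩ := hρE.exists_antitone
  obtain ⟨s, f, hsa, hf, hs0, hs, hsE, hsf⟩ := hσE.exists_antitone
  have hlog2 : 0 < Real.log 2 := Real.log_pos one_lt_two
  have hη0 : ∀ {p : ℕ → ℝ}, (∀ i, 0 ≤ p i) → HasSum p 1 → ∀ i, 0 ≤ Real.negMulLog (p i) :=
    fun hp0 hp i => Real.negMulLog_nonneg (hp0 i) (le_hasSum hp i fun j _ => hp0 j)
  have hηr := (EntropyBound.summable_and_tsum_le_of_tsum_ofReal_le (hη0 hr0 hr) hL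
    (hvar r e he hr0 hr hrE)).1
  have hηs := (EntropyBound.summable_and_tsum_le_of_tsum_ofReal_le (hη0 hs0 hs) hL
    (hvar s f hf hs0 hs hsE)).1
  have hent : ∀ {p : ℕ → ℝ}, (∀ i, 0 ≤ p i) → HasSum p 1 →
      (Summable fun i => Real.negMulLog (p i)) →
      ∑' i, ENNReal.ofReal (EntropyBound.negMulLogTwo (p i)) =
        ENNReal.ofReal ((∑' i, Real.negMulLog (p i)) / Real.log 2) := fun hp0 hp hηp => by
    rw [← tsum_div_const, ENNReal.ofReal_tsum_of_nonneg
      (fun i => div_nonneg (hη0 hp0 hp i) hlog2.le) (hηp.div_const _)]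
    rfl
  have hρe := EntropyBound.entropy_eq_tsum he hr0 hr hre
  have hσe := EntropyBound.entropy_eq_tsum hf hs0 hs hsf
  rw [hent hr0 hr hηr] at hρe
  rw [hent hs0 hs hηs] at hσe
  have hmax := EntropyBound.sum_max_le_of_traceNorm hρ hσ hε he hf hra hsa hr0
    (EntropyBound.apply_eq_of_hasSum_ketBra he hre) (EntropyBound.apply_eq_of_hasSum_ketBra hf hsf)
  -- The auxiliary distribution is placed on the eigenvectors `e` of ρ here, and on `f` in the
  -- reverse direction, so each uses its own energy hypothesis.
  have h1 := EntropyBound.tsum_negMulLog_sub_le_of_sum_max_le hr0 hs0 hr hs ε.coe_nonneg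
    (by exact_mod_cast hε1) hL hmax hηs
    fun p hp0 hp hpr => hvar p e he hp0 hp fun i hi => hrE i (hpr i hi)
  have h2 := EntropyBound.tsum_negMulLog_sub_le_of_sum_max_le hs0 hr0 hs hr ε.coe_nonneg
    (by exact_mod_cast hε1) hL (by simpa only [max_comm] using hmax) hηr
    fun p hp0 hp hps => hvar p f hf hp0 hp fun i hi => hsE i (hps i hi)
  rw [hγL, hρe, hσe]
  refine ⟨ENNReal.ofReal_ne_top, ENNReal.ofReal_ne_top, ENNReal.ofReal_ne_top, ?_⟩
  rw [ENNReal.toReal_ofReal (div_nonneg (tsum_nonneg (hη0 hr0 hr)) hlog2.le),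
    ENNReal.toReal_ofReal (div_nonneg (tsum_nonneg (hη0 hs0 hs)) hlog2.le),
    ENNReal.toReal_ofReal (div_nonneg hL hlog2.le)]
  have hbin : EntropyBound.binaryEntropy ε = Real.binEntropy ε / Real.log 2 := by
    rw [Real.binEntropy_eq_negMulLog_add_negMulLog_one_sub, add_div]
    rfl
  rw [hbin, ← sub_div, abs_div, abs_of_pos hlog2, mul_div_assoc', ← add_div]
  exact div_le_div_of_nonneg_right (abs_sub_le_iff.2 ⟨h1, h2⟩) hlog2.le
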